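/- Let $X$ be a fixed real $m\times p$ matrix, $A$ a fixed real $p\times n$ matrix, $\sigma\ge 0$, and let $Y = XA + E$, where $E$ is a random $m\times n$ matrix with independent $N(0,\sigma^2)$ entries. For a matrix $M$ let $\|M\|_F^2$ be the sum of its squared entries. For a $p\times n$ matrix $B$ let $r(B)$ be its rank and $J(B)\subseteq\{1,\dots,p\}$ the set of indices of its nonzero rows, and for $B\neq 0$ put $$\operatorname{pen}(B) = 12\,\sigma^2\, r(B)\Bigl\{2n + \log(2e)\,|J(B)| + |J(B)|\log\Bigl(\frac{ep}{|J(B)|}\Bigr)\Bigr\}.$$ Let $(B_j)_j$ be any finite or countably infinite collection of random $p\times n$ matrices, defined on the same probability space as $E$ and allowed to depend on the data in an arbitrary way, each almost surely nonzero. Let $\widetilde B$ be a random matrix which almost surely is a member of the collection minimizing $\|Y-XB_j\|_F^2+\operatorname{pen}(B_j)$ over $j$ (it is assumed that the minimum is attained). Then $$\mathbb E\bigl[\|XA-X\widetilde B\|_F^2\bigr]\le \inf_j\Bigl\{10\,\mathbb E\bigl[\|XA-XB_j\|_F^2\bigr]+8\,\mathbb E\bigl[\operatorname{pen}(B_j)\bigr]\Bigr\}+768\,n\sigma^2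 e^{-n/2},$$ where the expectations are those of nonnegative random variables, with values in $[0,\infty]$. -/

import Mathlib

open MeasureTheory ProbabilityTheory
open scoped NNReal ENNReal

noncomputable section

namespace JRRS

/-- The squared Frobenius norm: the sum of the squared entries. -/
def frobSq {a b : ℕ} (M : Matrix (Fin a) (Fin b) ℝ) : ℝ :=
  ∑ i, ∑ k, M i k ^ 2

open Classical in
/-- `J(B)`: the set of indices of the nonzero rows of `B`. -/
def rowSupport {p n : ℕ} (B : Matrix (Fin p) (Fin n) ℝ) : Finset (Fin p) :=
  Finset.univ.filter fun i => ∃ k, B i k ≠ 0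

/-- The joint rank and row penalty
`pen(B) = c σ² r(B) {2n + log(2e) |J(B)| + |J(B)| log(e p / |J(B)|)}`. -/
def pen (c σ : ℝ) {p n : ℕ} (B : Matrix (Fin p) (Fin n) ℝ) : ℝ :=
  c * σ ^ 2 * (B.rank : ℝ) *
    (2 * (n : ℝ) + Real.log (2 * Real.exp 1) * ((rowSupport B).card : ℝ) +
      ((rowSupport B).card : ℝ) *
        Real.log (Real.exp 1 * (p : ℝ) / ((rowSupport B).card : ℝ)))

/-- The penalized least squares criterion `‖Y - X B‖_F² + pen(B)`. -/
def criterion (c σ : ℝ) {m n p : ℕ} (Y : Matrix (Fin m) (Fin n) ℝ)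
    (X : Matrix (Fin m) (Fin p) ℝ) (B : Matrix (Fin p) (Fin n) ℝ) : ℝ :=
  frobSq (Y - X * B) + pen c σ B

/-- `Bsel` is a member of the family `B` at which the criterion is minimal over the family. -/
def IsSelected (c σ : ℝ) {m n p : ℕ} {ι : Type*} (Y : Matrix (Fin m) (Fin n) ℝ)
    (X : Matrix (Fin m) (Fin p) ℝ) (B : ι → Matrix (Fin p) (Fin n) ℝ)
    (Bsel : Matrix (Fin p) (Fin n) ℝ) : Prop :=
  ∃ j, Bsel = B j ∧ ∀ i, criterion c σ Y X (B j) ≤ criterion c σ Y X (B i)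

/-- The entries of the random matrix `E` are independent with law `N(0, σ²)`. -/
structure IsGaussianNoise {Ω : Type*} [MeasurableSpace Ω] (P : Measure Ω) (σ : ℝ≥0)
    {m n : ℕ} (E : Ω → Matrix (Fin m) (Fin n) ℝ) : Prop where
  indep : iIndepFun (fun (ik : Fin m × Fin n) (ω : Ω) => E ω ik.1 ik.2) P
  law : ∀ i k, HasLaw (fun ω => E ω i k) (gaussianReal 0 (σ ^ 2)) P

end JRRS

end

namespace JRRS

open Matrix

/-! Comparing the criterion at the selected matrix `C` and at a competitor `B` leaves the noise term
`2⟨E, XC - XB⟩`. It is at most half of `‖XC - XB‖²` plus rank times squared operator norm of the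
noise projected on the relevant columns of `X` (`abs_two_trace_le`). To make this splittable between
the two penalties, the difference is cut along the row space of the matrix of lower rank, so that
the larger rank never multiplies the row cost of the other matrix (`abs_two_trace_sub_le`,
`two_mul_noiseBound_le_pen`).

The operator norms are controlled for all row sets at once, by the method of mixtures rather than by
nets or concentration. For fixed `v`, `w` and a standard Gaussian `G`, `exp (g wᵀGv - g²|v|²|w|²/2)`
has mean one, hence so has its average over Gaussian `v`, `w`. That average dominates an exponential
of the square of any value of the form at unit vectors (`exp_le_gaussMixture`). A weighted sum `M`
over pairs of row sets has mean at most 30, and `log M ≤ n/2 + exp (-n/2 - 1) M` turns this into a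
bound linear in `M` (`IsGaussianNoise.exists_noiseBound`), whose expectation is the exponentially
small remainder. -/

/-! ### Low-rank matrices against the noise: deterministic bounds -/

/-- The columns of `F` are an orthonormal basis of the row space, so `F * Fᵀ` is the orthogonal
projection on it. Applied to a transpose, this yields a basis of a column space. -/
lemma exists_orthonormal_factor {p n : ℕ} (B : Matrix (Fin p) (Fin n) ℝ) :
    ∃ F : Matrix (Fin n) (Fin B.rank) ℝ, Fᵀ * F = 1 ∧ B * F * Fᵀ = B := by
  set e := (WithLp.linearEquiv 2 ℝ (Fin n → ℝ)).symm
  set S : Submodule ℝ (EuclideanSpace ℝ (Fin n)) :=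
    (Submodule.span ℝ (Set.range B.row)).map (e : (Fin n → ℝ) →ₗ[ℝ] _) with hS
  have hfin : Module.finrank ℝ S = B.rank := by
    rw [B.rank_eq_finrank_span_row, hS]
    exact LinearEquiv.finrank_map_eq e _
  set b := (stdOrthonormalBasis ℝ S).reindex (finCongr hfin)
  refine ⟨Matrix.of fun i k => (b k : EuclideanSpace ℝ (Fin n)) i, ?_, ?_⟩
  · ext k l
    have h := orthonormal_iff_ite.1 b.orthonormal l k
    rw [Submodule.coe_inner, PiLp.inner_apply] at h
    simp only [RCLike.inner_apply, conj_trivial] at h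
    rw [Matrix.mul_apply, Matrix.one_apply]
    simp only [transpose_apply, of_apply]
    rw [h]
    simp [eq_comm]
  · ext i j
    have hx : e (B.row i) ∈ S := Submodule.mem_map_of_mem (Submodule.subset_span ⟨i, rfl⟩)
    have h := b.sum_repr' ⟨e (B.row i), hx⟩
    have h2 := congrArg (fun x : S => (x : EuclideanSpace ℝ (Fin n)) j) h
    simp only [Submodule.coe_inner, PiLp.inner_apply, RCLike.inner_apply, conj_trivial,
      Submodule.coe_sum, Submodule.coe_smul, WithLp.ofLp_sum, WithLp.ofLp_smul, Finset.sum_apply,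
      Pi.smul_apply, smul_eq_mul] at h2
    have h3 : ∀ t, (e (B.row i)) t = B i t := fun t => rfl
    simp only [h3] at h2
    rw [← h2]
    simp only [Matrix.mul_apply, transpose_apply, of_apply]

lemma frobSq_eq_trace {a b : ℕ} (M : Matrix (Fin a) (Fin b) ℝ) : frobSq M = (Mᵀ * M).trace := by
  simp only [frobSq, Matrix.trace, diag_apply, Matrix.mul_apply, transpose_apply]
  rw [Finset.sum_comm]
  simp only [sq]

lemma frobSq_neg {a b : ℕ} (M : Matrix (Fin a) (Fin b) ℝ) : frobSq (-M) = frobSq M := by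
  simp [frobSq]

lemma frobSq_add {a b : ℕ} (M N : Matrix (Fin a) (Fin b) ℝ) :
    frobSq (M + N) = frobSq M + 2 * (Mᵀ * N).trace + frobSq N := by
  have : (Nᵀ * M).trace = (Mᵀ * N).trace := by
    rw [← Matrix.trace_transpose, transpose_mul, transpose_transpose]
  simp only [frobSq_eq_trace, transpose_add, Matrix.add_mul, Matrix.mul_add, trace_add, this]
  ring

/-- If the bilinear form of `Qᵀ E` has squared operator norm at most `s`, then `E` correlates
little with matrices of low rank whose columns lie in the range of `Q`. -/
lemma abs_two_trace_le {m n q : ℕ} (Q : Matrix (Fin m) (Fin q) ℝ)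
    (E D : Matrix (Fin m) (Fin n) ℝ) (hD : Q * Qᵀ * D = D)
    {s : ℝ} (hs0 : 0 ≤ s)
    (hs : ∀ (u : Fin q → ℝ) (v : Fin n → ℝ),
      (u ⬝ᵥ (Qᵀ * E) *ᵥ v) ^ 2 ≤ s * (u ⬝ᵥ u) * (v ⬝ᵥ v)) :
    |2 * (Eᵀ * D).trace| ≤ frobSq D / 2 + 2 * (D.rank : ℝ) * s := by
  obtain ⟨F, hF, hDF⟩ := exists_orthonormal_factor D
  set C := Qᵀ * D * F with hC
  set G := Qᵀ * E * F with hG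
  -- In the bases `Q` and `F` the trace becomes a sum of only `D.rank` terms, each a value of the
  -- bilinear form at a column of `C` and a unit column of `F`.
  have h1 : (Eᵀ * D).trace = (Cᵀ * G).trace := by
    rw [← Matrix.trace_transpose (Cᵀ * G), transpose_mul, transpose_transpose, hC, hG,
      transpose_mul, transpose_mul, transpose_transpose]
    calc (Eᵀ * D).trace = (Eᵀ * (Q * Qᵀ * D * F * Fᵀ)).trace := by rw [hD, hDF]
      _ = ((Eᵀ * Q * Qᵀ * D * F) * Fᵀ).trace := by simp only [Matrix.mul_assoc]
      _ = _ := by rw [Matrix.trace_mul_comm]; simp only [Matrix.mul_assoc]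
  have h2 : frobSq D = (Cᵀ * C).trace := by
    rw [frobSq_eq_trace, hC, transpose_mul, transpose_mul, transpose_transpose]
    calc (Dᵀ * D).trace = (Dᵀ * (Q * Qᵀ * D * F * Fᵀ)).trace := by rw [hD, hDF]
      _ = ((Dᵀ * Q * Qᵀ * D * F) * Fᵀ).trace := by simp only [Matrix.mul_assoc]
      _ = _ := by rw [Matrix.trace_mul_comm]; simp only [Matrix.mul_assoc]
  have hcol : ∀ k, |2 * (Cᵀ * G) k k| ≤ (Cᵀ * C) k k / 2 + 2 * s := by
    intro k
    have hf : (fun i => F i k) ⬝ᵥ (fun i => F i k) = 1 := by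
      have := congrFun (congrFun hF k) k
      simpa [Matrix.mul_apply, dotProduct] using this
    have h := hs (fun i => C i k) (fun i => F i k)
    have e1 : (fun i => C i k) ⬝ᵥ (Qᵀ * E) *ᵥ (fun i => F i k) = (Cᵀ * G) k k := by
      rw [hG, Matrix.mul_apply]; rfl
    have e2 : (fun i => C i k) ⬝ᵥ (fun i => C i k) = (Cᵀ * C) k k := by
      rw [Matrix.mul_apply]; rfl
    rw [e1, e2, hf, mul_one] at h
    have hc : 0 ≤ (Cᵀ * C) k k := by
      rw [← e2]; exact Finset.sum_nonneg fun i _ => mul_self_nonneg _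
    -- With `c = |C_k|²`, the square is at most `4 s c`, and `4 s c ≤ (c / 2 + 2 s)²`.
    apply abs_le_of_sq_le_sq _ (by positivity)
    nlinarith [sq_nonneg ((Cᵀ * C) k k / 2 - 2 * s)]
  rw [h1, h2, Matrix.trace, Matrix.trace, Finset.mul_sum]
  calc |∑ k, 2 * (Cᵀ * G).diag k| ≤ ∑ k, |2 * (Cᵀ * G).diag k| := Finset.abs_sum_le_sum_abs _ _
    _ ≤ ∑ k, ((Cᵀ * C).diag k / 2 + 2 * s) := Finset.sum_le_sum fun k _ => hcol k
    _ = _ := by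
      rw [Finset.sum_add_distrib, Finset.sum_div]
      simp; ring

/-- The matrix `X` with the columns outside `J` replaced by zero. -/
noncomputable def restrictCols {m p : ℕ} (X : Matrix (Fin m) (Fin p) ℝ) (J : Finset (Fin p)) :
    Matrix (Fin m) (Fin p) ℝ :=
  X * diagonal fun i => if i ∈ J then (1 : ℝ) else 0

lemma restrictCols_mul {m n p : ℕ} (X : Matrix (Fin m) (Fin p) ℝ) (B : Matrix (Fin p) (Fin n) ℝ)
    {J : Finset (Fin p)} (hJ : rowSupport B ⊆ J) : restrictCols X J * B = X * B := by
  rw [restrictCols, Matrix.mul_assoc]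
  congr 1
  ext i k
  rw [diagonal_mul]
  split_ifs with h
  · simp
  · have : i ∉ rowSupport B := fun h' => h (hJ h')
    simp only [rowSupport, Finset.mem_filter, Finset.mem_univ, true_and, not_exists, not_not] at this
    simp [this k]

lemma rank_restrictCols_le {m p : ℕ} (X : Matrix (Fin m) (Fin p) ℝ) (J : Finset (Fin p)) :
    (restrictCols X J)ᵀ.rank ≤ J.card := by
  rw [Matrix.rank_transpose]
  refine (Matrix.rank_mul_le_right _ _).trans ?_
  rw [Matrix.rank_diagonal, Fintype.card_subtype]
  refine Finset.card_le_card fun i => ?_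
  simp

/-- An orthonormal basis, arranged in columns, of the span of the columns of `X` in `J`. -/
noncomputable def colBasis {m p : ℕ} (X : Matrix (Fin m) (Fin p) ℝ) (J : Finset (Fin p)) :
    Matrix (Fin m) (Fin (restrictCols X J)ᵀ.rank) ℝ :=
  (exists_orthonormal_factor (restrictCols X J)ᵀ).choose

lemma colBasis_orthonormal {m p : ℕ} (X : Matrix (Fin m) (Fin p) ℝ) (J : Finset (Fin p)) :
    (colBasis X J)ᵀ * colBasis X J = 1 :=
  (exists_orthonormal_factor (restrictCols X J)ᵀ).choose_spec.1

lemma colBasis_proj_mul {m n p : ℕ} (X : Matrix (Fin m) (Fin p) ℝ) (B : Matrix (Fin p) (Fin n) ℝ)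
    {J : Finset (Fin p)} (hJ : rowSupport B ⊆ J) :
    colBasis X J * (colBasis X J)ᵀ * (X * B) = X * B := by
  have h := congrArg Matrix.transpose (exists_orthonormal_factor (restrictCols X J)ᵀ).choose_spec.2
  change (_ * colBasis X J * (colBasis X J)ᵀ)ᵀ = _ at h
  simp only [transpose_mul, transpose_transpose] at h
  rw [← restrictCols_mul X B hJ, ← Matrix.mul_assoc]
  conv_rhs => rw [← h]
  simp only [Matrix.mul_assoc]

/-- `s` bounds the squared operator norm of the projection of `E` on the columns of `X` in `J`. -/
def ProjBound {m n p : ℕ} (X : Matrix (Fin m) (Fin p) ℝ) (E : Matrix (Fin m) (Fin n) ℝ)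
    (J : Finset (Fin p)) (s : ℝ) : Prop :=
  0 ≤ s ∧ ∀ (u : Fin (restrictCols X J)ᵀ.rank → ℝ) (v : Fin n → ℝ),
    (u ⬝ᵥ ((colBasis X J)ᵀ * E) *ᵥ v) ^ 2 ≤ s * (u ⬝ᵥ u) * (v ⬝ᵥ v)

/-- Projecting the rows of the difference on the row space of `B₁` leaves rank at most `r(B₁)`. The
complementary part no longer sees `B₁`, so it has rank at most `r(B₂)` and involves only the columns
of `X` in the support of `B₂`. The two parts are orthogonal, so their halved squared norms add up
exactly. -/
lemma abs_two_trace_sub_le {m n p : ℕ} (X : Matrix (Fin m) (Fin p) ℝ)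
    (E : Matrix (Fin m) (Fin n) ℝ) (B₁ B₂ : Matrix (Fin p) (Fin n) ℝ) {s₁ s₂ : ℝ}
    (h₁ : ProjBound X E (rowSupport B₁ ∪ rowSupport B₂) s₁)
    (h₂ : ProjBound X E (rowSupport B₂) s₂) :
    |2 * (Eᵀ * (X * B₁ - X * B₂)).trace| ≤ frobSq (X * B₁ - X * B₂) / 2 +
      2 * ((B₁.rank : ℝ) * s₁ + (B₂.rank : ℝ) * s₂) := by
  obtain ⟨F, hF, hBF⟩ := exists_orthonormal_factor B₁
  set D := X * B₁ - X * B₂ with hD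
  set K := F * Fᵀ with hK
  have hKt : Kᵀ = K := by rw [hK, transpose_mul, transpose_transpose]
  have hKK : K * K = K := by
    rw [hK, Matrix.mul_assoc, ← Matrix.mul_assoc Fᵀ, hF, Matrix.one_mul]
  set D₁ := D * K with hD₁
  set D₂ := D * (1 - K) with hD₂
  have hsum : D₁ + D₂ = D := by rw [hD₁, hD₂, ← Matrix.mul_add]; simp
  have hBK : B₁ * K = B₁ := by rw [hK, ← Matrix.mul_assoc, hBF]
  have hD₂' : D₂ = -(X * B₂ * (1 - K)) := by
    rw [hD₂, hD, Matrix.sub_mul, Matrix.mul_assoc X B₁, Matrix.mul_sub, Matrix.mul_one, hBK]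
    simp
  have horth : (D₁ᵀ * D₂).trace = 0 := by
    rw [hD₁, hD₂, transpose_mul, hKt, Matrix.mul_assoc, Matrix.trace_mul_comm]
    have : (1 - K) * K = 0 := by rw [Matrix.sub_mul, Matrix.one_mul, hKK, sub_self]
    simp only [Matrix.mul_assoc, this, Matrix.mul_zero, trace_zero]
  have hnorm : frobSq D = frobSq D₁ + frobSq D₂ := by
    rw [← hsum, frobSq_add, horth]; ring
  have hr₁ : (D₁.rank : ℝ) ≤ B₁.rank := by
    have h : D₁.rank ≤ Fᵀ.rank := by
      rw [hD₁, hK, ← Matrix.mul_assoc]; exact Matrix.rank_mul_le_right _ _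
    exact_mod_cast h.trans ((Matrix.rank_le_card_height _).trans (by simp))
  have hr₂ : (D₂.rank : ℝ) ≤ B₂.rank := by
    have e : D₂ = X * (B₂ * (-(1 - K))) := by
      rw [hD₂', Matrix.mul_neg, Matrix.mul_neg, Matrix.mul_assoc]
    rw [e]
    exact Nat.cast_le.2
      ((Matrix.rank_mul_le_right X _).trans (Matrix.rank_mul_le_left B₂ (-(1 - K))))
  have hp₁ : colBasis X (rowSupport B₁ ∪ rowSupport B₂) *
      (colBasis X (rowSupport B₁ ∪ rowSupport B₂))ᵀ * D₁ = D₁ := by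
    rw [hD₁, ← Matrix.mul_assoc, hD, Matrix.mul_sub,
      colBasis_proj_mul X B₁ Finset.subset_union_left,
      colBasis_proj_mul X B₂ Finset.subset_union_right]
  have hp₂ : colBasis X (rowSupport B₂) * (colBasis X (rowSupport B₂))ᵀ * D₂ = D₂ := by
    rw [hD₂', Matrix.mul_neg, ← Matrix.mul_assoc, colBasis_proj_mul X B₂ subset_rfl]
  have b₁ := abs_two_trace_le _ E D₁ hp₁ h₁.1 h₁.2
  have b₂ := abs_two_trace_le _ E D₂ hp₂ h₂.1 h₂.2
  have e : 2 * (Eᵀ * D).trace = 2 * (Eᵀ * D₁).trace + 2 * (Eᵀ * D₂).trace := by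
    rw [← hsum, Matrix.mul_add, trace_add]; ring
  rw [e, hnorm]
  refine (abs_add_le _ _).trans ?_
  have := mul_le_mul_of_nonneg_right hr₁ h₁.1
  have := mul_le_mul_of_nonneg_right hr₂ h₂.1
  linarith

/-! ### Gaussian mixtures and their lower bounds -/

/-- The standard Gaussian measure on `ℝᴺ`. -/
noncomputable def stdGauss (N : ℕ) : Measure (Fin N → ℝ) := Measure.pi fun _ => gaussianReal 0 1

instance (N : ℕ) : IsProbabilityMeasure (stdGauss N) := by unfold stdGauss; infer_instance

/-- The integral equals `(1 + b)^(-1/2) exp (z² / (2 (1 + b)))`. Bounding the square below by its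
tangent at a free shift `a`, and `√(1 + b)` above by `exp (b / 2)`, makes the exponent affine in `z`
and in `b`; this is what allows a second Gaussian integration afterwards. -/
lemma le_lintegral_exp_gaussianReal (z a : ℝ) {b : ℝ} (hb : 0 ≤ b) :
    ENNReal.ofReal (Real.exp (z * a - (1 + b) * a ^ 2 / 2 - b / 2)) ≤
      ∫⁻ x, ENNReal.ofReal (Real.exp (z * x - b * x ^ 2 / 2)) ∂gaussianReal 0 1 := by
  have hb1 : 0 < 1 + b := by linarith
  set v : ℝ≥0 := (Real.toNNReal (1 + b))⁻¹ with hv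
  have hv0 : v ≠ 0 := by
    rw [hv]; exact inv_ne_zero (by simpa using hb1)
  have hvc : (v : ℝ) = (1 + b)⁻¹ := by rw [hv]; simp [hb1.le]
  set K := Real.exp (z * a - (1 + b) * a ^ 2 / 2 - b / 2) with hK
  rw [gaussianReal_of_var_ne_zero 0 one_ne_zero,
    lintegral_withDensity_eq_lintegral_mul _ (measurable_gaussianPDF 0 1) (by fun_prop)]
  -- Completing the square in the integrand produces the density with mean `z / (1 + b)` and
  -- variance `1 / (1 + b)`; the comparison is then pointwise.
  calc ENNReal.ofReal K = ENNReal.ofReal K * ∫⁻ x, gaussianPDF (z / (1 + b)) v x := by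
        rw [lintegral_gaussianPDF_eq_one _ hv0, mul_one]
    _ = ∫⁻ x, ENNReal.ofReal K * gaussianPDF (z / (1 + b)) v x := by
        rw [lintegral_const_mul _ (measurable_gaussianPDF _ _)]
    _ ≤ _ := by
        refine lintegral_mono fun x => ?_
        simp only [Pi.mul_apply, gaussianPDF]
        rw [← ENNReal.ofReal_mul (Real.exp_pos _).le,
          ← ENNReal.ofReal_mul (gaussianPDFReal_nonneg _ _ _)]
        refine ENNReal.ofReal_le_ofReal ?_
        simp only [gaussianPDFReal, hvc, NNReal.coe_one, mul_one, sub_zero]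
        have hs : (√(2 * Real.pi * (1 + b)⁻¹))⁻¹ = (√(2 * Real.pi))⁻¹ * √(1 + b) := by
          rw [Real.sqrt_mul (by positivity), Real.sqrt_inv, mul_inv, inv_inv]
        have hsq : √(1 + b) ≤ Real.exp (b / 2) := by
          rw [Real.sqrt_le_left (Real.exp_pos _).le, ← Real.exp_nat_mul]
          have := Real.add_one_le_exp b
          have e : ((2 : ℕ) : ℝ) * (b / 2) = b := by push_cast; ring
          rw [e]; linarith
        rw [hs]
        have hexp : -(x - z / (1 + b)) ^ 2 / (2 * (1 + b)⁻¹) =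
            -(x ^ 2) / 2 + (z * x - b * x ^ 2 / 2) - z ^ 2 / (2 * (1 + b)) := by
          field_simp; ring
        rw [hexp]
        have hquad : z * a - (1 + b) * a ^ 2 / 2 - z ^ 2 / (2 * (1 + b)) ≤ 0 := by
          have : z * a - (1 + b) * a ^ 2 / 2 - z ^ 2 / (2 * (1 + b)) =
              -((1 + b) * a - z) ^ 2 / (2 * (1 + b)) := by field_simp; ring
          rw [this]
          exact div_nonpos_of_nonpos_of_nonneg (by nlinarith [sq_nonneg ((1 + b) * a - z)])
            (by positivity)
        calc K * ((√(2 * Real.pi))⁻¹ * √(1 + b) *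
              Real.exp (-(x ^ 2) / 2 + (z * x - b * x ^ 2 / 2) - z ^ 2 / (2 * (1 + b))))
            ≤ K * ((√(2 * Real.pi))⁻¹ * Real.exp (b / 2) *
              Real.exp (-(x ^ 2) / 2 + (z * x - b * x ^ 2 / 2) - z ^ 2 / (2 * (1 + b)))) := by
              gcongr
          _ = (√(2 * Real.pi))⁻¹ * Real.exp ((z * a - (1 + b) * a ^ 2 / 2 - z ^ 2 / (2 * (1 + b))) +
              (-(x ^ 2) / 2 + (z * x - b * x ^ 2 / 2))) := by
              rw [hK, mul_assoc, mul_left_comm, ← Real.exp_add, ← Real.exp_add]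
              congr 2
              ring
          _ ≤ (√(2 * Real.pi))⁻¹ * Real.exp (-(x ^ 2) / 2 + (z * x - b * x ^ 2 / 2)) := by
              refine mul_le_mul_of_nonneg_left (Real.exp_le_exp.2 ?_) (by positivity)
              linarith
          _ = _ := by rw [Real.exp_add, mul_assoc]

lemma le_lintegral_exp_stdGauss {N : ℕ} (z a : Fin N → ℝ) {b : ℝ} (hb : 0 ≤ b) :
    ENNReal.ofReal (Real.exp (z ⬝ᵥ a - (1 + b) * (a ⬝ᵥ a) / 2 - N * b / 2)) ≤
      ∫⁻ x, ENNReal.ofReal (Real.exp (z ⬝ᵥ x - b * (x ⬝ᵥ x) / 2)) ∂stdGauss N := by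
  have hR : ∀ x : Fin N → ℝ, ENNReal.ofReal (Real.exp (z ⬝ᵥ x - b * (x ⬝ᵥ x) / 2)) =
      ∏ i, ENNReal.ofReal (Real.exp (z i * x i - b * x i ^ 2 / 2)) := by
    intro x
    rw [← ENNReal.ofReal_prod_of_nonneg fun i _ => (Real.exp_pos _).le, ← Real.exp_sum]
    simp only [dotProduct, Finset.sum_sub_distrib, Finset.mul_sum, Finset.sum_div, sq]
  have hL : ENNReal.ofReal (Real.exp (z ⬝ᵥ a - (1 + b) * (a ⬝ᵥ a) / 2 - N * b / 2)) =
      ∏ i, ENNReal.ofReal (Real.exp (z i * a i - (1 + b) * a i ^ 2 / 2 - b / 2)) := by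
    rw [← ENNReal.ofReal_prod_of_nonneg fun i _ => (Real.exp_pos _).le, ← Real.exp_sum]
    simp only [dotProduct, Finset.sum_sub_distrib, Finset.mul_sum, Finset.sum_div, sq,
      Finset.sum_const, Finset.card_univ, Fintype.card_fin, nsmul_eq_mul, mul_div_assoc]
  simp only [hR]
  rw [hL]
  have hind := iIndepFun_pi (μ := fun _ : Fin N => gaussianReal 0 1)
    (X := fun i (x : ℝ) => ENNReal.ofReal (Real.exp (z i * x - b * x ^ 2 / 2)))
    (fun i => by fun_prop)
  have := lintegral_prod_eq_prod_lintegral_of_indepFun Finset.univ _ hind (fun i => by fun_prop)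
  rw [stdGauss, this]
  refine Finset.prod_le_prod' fun i _ => ?_
  rw [(measurePreserving_eval (fun _ : Fin N => gaussianReal 0 1) i).lintegral_comp
    (f := fun x : ℝ => ENNReal.ofReal (Real.exp (z i * x - b * x ^ 2 / 2))) (by fun_prop)]
  exact le_lintegral_exp_gaussianReal _ _ hb

/-- The mixture, over independent Gaussian vectors `v` and `w`, of the exponentials
`exp (g wᵀGv - g² |v|² |w|² / 2)`, which have mean one for a standard Gaussian matrix `G`. -/
noncomputable def gaussMixture {q n : ℕ} (g : ℝ) (G : Matrix (Fin q) (Fin n) ℝ) : ℝ≥0∞ :=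
  ∫⁻ x : (Fin n → ℝ) × (Fin q → ℝ),
    ENNReal.ofReal (Real.exp (g * (x.2 ⬝ᵥ G *ᵥ x.1) - g ^ 2 * (x.1 ⬝ᵥ x.1) * (x.2 ⬝ᵥ x.2) / 2))
      ∂(stdGauss n).prod (stdGauss q)

/-- The one-vector bound is used twice: over the second vector with shift `c • u`, which leaves a
Gaussian integrand of the same shape in the first vector, then over that one with shift `h • v`. -/
lemma exp_le_gaussMixture_of_shift {q n : ℕ} (g c h : ℝ) (G : Matrix (Fin q) (Fin n) ℝ)
    {u : Fin q → ℝ} {v : Fin n → ℝ} (hu : u ⬝ᵥ u = 1) (hv : v ⬝ᵥ v = 1) :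
    ENNReal.ofReal (Real.exp (h * c * g * (u ⬝ᵥ G *ᵥ v) - (1 + g ^ 2 * (c ^ 2 + q)) * h ^ 2 / 2 -
      n * (g ^ 2 * (c ^ 2 + q)) / 2 - c ^ 2 / 2)) ≤ gaussMixture g G := by
  have hmeas : Measurable fun x : (Fin n → ℝ) × (Fin q → ℝ) => ENNReal.ofReal (Real.exp
      (g * (x.2 ⬝ᵥ G *ᵥ x.1) - g ^ 2 * (x.1 ⬝ᵥ x.1) * (x.2 ⬝ᵥ x.2) / 2)) := by
    unfold dotProduct mulVec dotProduct
    fun_prop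
  rw [gaussMixture, lintegral_prod _ hmeas.aemeasurable]
  have hin : ∀ x : Fin n → ℝ, ENNReal.ofReal (Real.exp (-(c ^ 2 / 2))) * ENNReal.ofReal (Real.exp
      (((c * g) • (u ᵥ* G)) ⬝ᵥ x - (g ^ 2 * (c ^ 2 + q)) * (x ⬝ᵥ x) / 2)) ≤
      ∫⁻ y, ENNReal.ofReal (Real.exp
        (g * (y ⬝ᵥ G *ᵥ x) - g ^ 2 * (x ⬝ᵥ x) * (y ⬝ᵥ y) / 2)) ∂stdGauss q := by
    intro x
    have hx : 0 ≤ x ⬝ᵥ x := Finset.sum_nonneg fun i _ => mul_self_nonneg _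
    have := le_lintegral_exp_stdGauss (g • (G *ᵥ x)) (c • u) (b := g ^ 2 * (x ⬝ᵥ x)) (by positivity)
    rw [← ENNReal.ofReal_mul (Real.exp_pos _).le, ← Real.exp_add]
    convert this using 4
    · simp only [smul_dotProduct, dotProduct_smul, smul_eq_mul, hu, ← dotProduct_mulVec]
      rw [dotProduct_comm (G *ᵥ x) u]
      ring
    · rename_i y
      rw [smul_dotProduct, dotProduct_comm (G *ᵥ x) y, smul_eq_mul]
  refine le_trans ?_ (lintegral_mono hin)
  rw [lintegral_const_mul _ (by unfold dotProduct; fun_prop)]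
  have := le_lintegral_exp_stdGauss ((c * g) • (u ᵥ* G)) (h • v) (b := g ^ 2 * (c ^ 2 + q))
    (by positivity)
  refine le_trans (le_of_eq ?_) (mul_le_mul_right this _)
  rw [← ENNReal.ofReal_mul (Real.exp_pos _).le, ← Real.exp_add]
  congr 2
  simp only [smul_dotProduct, dotProduct_smul, smul_eq_mul, hv, ← dotProduct_mulVec]
  ring

lemma exp_le_gaussMixture {q n : ℕ} {g : ℝ} (hg : g ^ 2 * n = 2 / 5)
    (G : Matrix (Fin q) (Fin n) ℝ) {u : Fin q → ℝ} {v : Fin n → ℝ}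
    (hu : u ⬝ᵥ u = 1) (hv : v ⬝ᵥ v = 1) :
    ENNReal.ofReal (Real.exp ((u ⬝ᵥ G *ᵥ v) ^ 2 / 3 - 7 / 2 * n - 8 / 5 * q)) ≤
      gaussMixture g G := by
  have hg0 : g ≠ 0 := by rintro rfl; norm_num at hg
  set d := √(14 / 5) with hd
  -- The shift along `v` is `h = d / g`, so `h² = 7 n`. Since `g² (h² + n) / 2 = 8 / 5`, the
  -- exponent is `d y c - (21 / 10) c² - 7 n / 2 - 8 q / 5`, which is maximal at `c = d y / (21 /
  -- 5)`, with leading term `y² / 3`.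
  have hd2 : d ^ 2 = 14 / 5 := Real.sq_sqrt (by norm_num)
  set y := u ⬝ᵥ G *ᵥ v with hy
  refine le_trans (le_of_eq ?_)
    (exp_le_gaussMixture_of_shift g (d * y / (21 / 5)) (d / g) G hu hv)
  congr 2
  have hh : (d / g) ^ 2 = 7 * n := by
    rw [div_pow, hd2, div_eq_iff (pow_ne_zero 2 hg0)]
    linear_combination (-7) * hg
  have hc : (d * y / (21 / 5)) ^ 2 = 10 / 63 * y ^ 2 := by
    rw [div_pow, mul_pow, hd2]; ring
  have hx : d / g * (d * y / (21 / 5)) * g * y = 2 / 3 * y ^ 2 := by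
    have : d / g * (d * y / (21 / 5)) * g * y = d ^ 2 * y ^ 2 / (21 / 5) := by field_simp
    rw [this, hd2]; ring
  rw [← hy, hx, hh, hc]
  linear_combination (4 : ℝ) * (10 / 63 * y ^ 2 + q) * hg

/-! ### Expectation of the mixture under the noise -/

section Expectation

variable {Ω : Type*} [MeasurableSpace Ω] {P : Measure Ω} {m n q : ℕ}
  {σ : ℝ≥0} {E : Ω → Matrix (Fin m) (Fin n) ℝ}

lemma IsGaussianNoise.lintegral_exp_sum [IsProbabilityMeasure P] (hE : IsGaussianNoise P σ E)
    (a : Fin m × Fin n → ℝ) :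
    ∫⁻ ω, ENNReal.ofReal (Real.exp (∑ i, a i * E ω i.1 i.2)) ∂P =
      ENNReal.ofReal (Real.exp (σ ^ 2 * (∑ i, a i ^ 2) / 2)) := by
  have hm : ∀ i : Fin m × Fin n, AEMeasurable (fun ω => E ω i.1 i.2) P :=
    fun i => (hE.law i.1 i.2).aemeasurable
  have hind : iIndepFun (fun i ω => a i * E ω i.1 i.2) P :=
    hE.indep.comp (fun i x => a i * x) (fun i => by fun_prop)
  have hmgf := hind.mgf_sum₀ (t := 1) (fun i => (hm i).const_mul (a i)) Finset.univ
  have hone : ∀ i, mgf (fun ω => a i * E ω i.1 i.2) P 1 =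
      Real.exp (σ ^ 2 * a i ^ 2 / 2) := by
    intro i
    rw [mgf_const_mul, mgf_gaussianReal (hE.law i.1 i.2).map_eq]
    simp
  have hval : mgf (∑ i, fun ω => a i * E ω i.1 i.2) P 1 =
      Real.exp (σ ^ 2 * (∑ i, a i ^ 2) / 2) := by
    rw [hmgf]
    simp only [hone, ← Real.exp_sum, Finset.mul_sum, Finset.sum_div]
  -- The moment generating function would be zero, as a Bochner integral, if the exponential were
  -- not integrable; its positive value gives integrability.
  have hint := mgf_pos_iff.1 (hval ▸ Real.exp_pos _)
  rw [mgf] at hval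
  simp only [one_mul, Finset.sum_apply] at hval hint
  rw [← ofReal_integral_eq_lintegral_ofReal hint (.of_forall fun _ => (Real.exp_pos _).le), hval]

lemma dotProduct_mulVec_eq_sum (Q : Matrix (Fin m) (Fin q) ℝ) (M : Matrix (Fin m) (Fin n) ℝ)
    (w : Fin q → ℝ) (v : Fin n → ℝ) :
    w ⬝ᵥ (Qᵀ * M) *ᵥ v = ∑ i : Fin m × Fin n, (Q *ᵥ w) i.1 * v i.2 * M i.1 i.2 := by
  rw [← mulVec_mulVec, dotProduct_mulVec, vecMul_transpose, Fintype.sum_prod_type]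
  simp only [dotProduct, mulVec, Finset.mul_sum]
  refine Finset.sum_congr rfl fun i _ => Finset.sum_congr rfl fun k _ => ?_
  ring

lemma sum_sq_mulVec (Q : Matrix (Fin m) (Fin q) ℝ) (hQ : Qᵀ * Q = 1)
    (w : Fin q → ℝ) (v : Fin n → ℝ) :
    ∑ i : Fin m × Fin n, ((Q *ᵥ w) i.1 * v i.2) ^ 2 = (w ⬝ᵥ w) * (v ⬝ᵥ v) := by
  have h : (Q *ᵥ w) ⬝ᵥ (Q *ᵥ w) = w ⬝ᵥ w := by
    rw [dotProduct_mulVec, ← mulVec_transpose, mulVec_mulVec, hQ, one_mulVec]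
  rw [← h, Fintype.sum_prod_type, dotProduct, dotProduct, Finset.sum_mul_sum]
  refine Finset.sum_congr rfl fun i _ => Finset.sum_congr rfl fun k _ => ?_
  ring

lemma IsGaussianNoise.aemeasurable_mixture_integrand (hE : IsGaussianNoise P σ E) (g : ℝ)
    (Q : Matrix (Fin m) (Fin q) ℝ) :
    AEMeasurable (fun z : Ω × ((Fin n → ℝ) × (Fin q → ℝ)) => ENNReal.ofReal (Real.exp
      (g * (z.2.2 ⬝ᵥ (Qᵀ * ((σ : ℝ)⁻¹ • E z.1)) *ᵥ z.2.1) -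
        g ^ 2 * (z.2.1 ⬝ᵥ z.2.1) * (z.2.2 ⬝ᵥ z.2.2) / 2)))
      (P.prod ((stdGauss n).prod (stdGauss q))) := by
  have hm : ∀ i : Fin m × Fin n, AEMeasurable (fun z : Ω × ((Fin n → ℝ) × (Fin q → ℝ)) =>
      E z.1 i.1 i.2) (P.prod ((stdGauss n).prod (stdGauss q))) :=
    fun i => (hE.law i.1 i.2).aemeasurable.comp_fst
  have h1 : AEMeasurable (fun z : Ω × ((Fin n → ℝ) × (Fin q → ℝ)) =>
      z.2.2 ⬝ᵥ (Qᵀ * ((σ : ℝ)⁻¹ • E z.1)) *ᵥ z.2.1)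
      (P.prod ((stdGauss n).prod (stdGauss q))) := by
    simp only [dotProduct_mulVec_eq_sum, Matrix.smul_apply, smul_eq_mul]
    refine Finset.aemeasurable_fun_sum _ fun i _ => AEMeasurable.mul ?_ ((hm i).const_mul _)
    refine Measurable.aemeasurable ?_
    unfold mulVec dotProduct
    fun_prop
  have h2 : Measurable fun z : Ω × ((Fin n → ℝ) × (Fin q → ℝ)) =>
      g ^ 2 * (z.2.1 ⬝ᵥ z.2.1) * (z.2.2 ⬝ᵥ z.2.2) / 2 := by
    unfold dotProduct; fun_prop
  exact (Real.measurable_exp.comp_aemeasurable ((h1.const_mul g).sub h2.aemeasurable)).ennreal_ofReal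

lemma IsGaussianNoise.aemeasurable_gaussMixture (hE : IsGaussianNoise P σ E) (g : ℝ)
    (Q : Matrix (Fin m) (Fin q) ℝ) :
    AEMeasurable (fun ω => gaussMixture g (Qᵀ * ((σ : ℝ)⁻¹ • E ω))) P :=
  (hE.aemeasurable_mixture_integrand g Q).lintegral_prod_right'

/-- By Tonelli it suffices to fix both vectors. As `Q` is an isometry, the linear term is then a
centred Gaussian of variance `g² |v|² |w|²`, and the subtracted quadratic term is exactly its
compensator. -/
lemma IsGaussianNoise.lintegral_gaussMixture [IsProbabilityMeasure P] (hE : IsGaussianNoise P σ E) (hσ : σ ≠ 0) (g : ℝ)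
    (Q : Matrix (Fin m) (Fin q) ℝ) (hQ : Qᵀ * Q = 1) :
    ∫⁻ ω, gaussMixture g (Qᵀ * ((σ : ℝ)⁻¹ • E ω)) ∂P = 1 := by
  have hσ' : (σ : ℝ) ≠ 0 := by exact_mod_cast hσ
  unfold gaussMixture
  rw [lintegral_lintegral_swap (hE.aemeasurable_mixture_integrand g Q)]
  have : ∀ x : (Fin n → ℝ) × (Fin q → ℝ), ∫⁻ ω, ENNReal.ofReal (Real.exp
      (g * (x.2 ⬝ᵥ (Qᵀ * ((σ : ℝ)⁻¹ • E ω)) *ᵥ x.1) -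
        g ^ 2 * (x.1 ⬝ᵥ x.1) * (x.2 ⬝ᵥ x.2) / 2)) ∂P = 1 := by
    intro x
    have e : ∀ ω, ENNReal.ofReal (Real.exp (g * (x.2 ⬝ᵥ (Qᵀ * ((σ : ℝ)⁻¹ • E ω)) *ᵥ x.1) -
        g ^ 2 * (x.1 ⬝ᵥ x.1) * (x.2 ⬝ᵥ x.2) / 2)) =
        ENNReal.ofReal (Real.exp (-(g ^ 2 * (x.1 ⬝ᵥ x.1) * (x.2 ⬝ᵥ x.2) / 2))) *
        ENNReal.ofReal (Real.exp (∑ i : Fin m × Fin n,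
          (g * (σ : ℝ)⁻¹ * ((Q *ᵥ x.2) i.1 * x.1 i.2)) * E ω i.1 i.2)) := by
      intro ω
      rw [← ENNReal.ofReal_mul (Real.exp_pos _).le, ← Real.exp_add, dotProduct_mulVec_eq_sum,
        Finset.mul_sum, sub_eq_neg_add]
      congr 3
      refine Finset.sum_congr rfl fun i _ => ?_
      simp only [Matrix.smul_apply, smul_eq_mul]
      ring
    simp only [e]
    rw [lintegral_const_mul' _ _ ENNReal.ofReal_ne_top, hE.lintegral_exp_sum,
      ← ENNReal.ofReal_mul (Real.exp_pos _).le, ← Real.exp_add]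
    simp only [mul_pow _ _ 2, ← Finset.mul_sum]
    have hs := sum_sq_mulVec Q hQ x.2 x.1
    simp only [mul_pow _ _ 2] at hs
    rw [hs]
    have : -(g ^ 2 * (x.1 ⬝ᵥ x.1) * (x.2 ⬝ᵥ x.2) / 2) +
        (σ : ℝ) ^ 2 * (g ^ 2 * (σ : ℝ)⁻¹ ^ 2 * ((x.2 ⬝ᵥ x.2) * (x.1 ⬝ᵥ x.1))) / 2 = 0 := by
      field_simp; ring
    rw [this]; simp
  simp only [this]
  simp

lemma IsGaussianNoise.ae_eq_zero (hE : IsGaussianNoise P 0 E) : ∀ᵐ ω ∂P, E ω = 0 := by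
  have h : ∀ i k, ∀ᵐ ω ∂P, E ω i k = 0 := by
    intro i k
    have := hE.law i k
    simp only [ne_eq, OfNat.ofNat_ne_zero, not_false_eq_true, zero_pow,
      gaussianReal_zero_var] at this
    exact this.ae_eq_of_dirac
  have h' := ae_all_iff.2 fun i => ae_all_iff.2 (h i)
  filter_upwards [h'] with ω hω
  ext i k
  exact hω i k

end Expectation

/-! ### Weights and costs of row sets -/

/-- The weight of a set of `k` among `p` rows in the union bound. -/
noncomputable def rowWeight (p k : ℕ) : ℝ :=
  Real.exp (-(k * Real.log (Real.exp 1 * p / k)) - 9 / 100 * k)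

lemma rowWeight_pos (p k : ℕ) : 0 < rowWeight p k := Real.exp_pos _

/-- From `p.choose k ≤ p^k / k!`, the logarithmic part of the weight leaves `(k/e)^k / k!`, at most
`1 / √(2πk) ≤ 2 / 5` by Stirling. The extra `exp (-9k/100)` supplies the geometric decay. -/
lemma choose_mul_rowWeight_le {p k : ℕ} (hk : 1 ≤ k) (hkp : k ≤ p) :
    (p.choose k : ℝ) * rowWeight p k ≤ 2 / 5 * (100 / 109) ^ k := by
  have hk0 : (0 : ℝ) < k := by exact_mod_cast hk
  have hp0 : (0 : ℝ) < p := by exact_mod_cast hk.trans hkp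
  have he : (0 : ℝ) < Real.exp 1 := Real.exp_pos 1
  have h1 : Real.exp (-(k * Real.log (Real.exp 1 * p / k))) = (k / (Real.exp 1 * p)) ^ k := by
    rw [← mul_neg, ← Real.log_inv, inv_div, Real.exp_nat_mul, Real.exp_log (by positivity)]
  have h2 : Real.exp (-(9 / 100 * k)) ≤ (100 / 109) ^ k := by
    rw [show -(9 / 100 * (k : ℝ)) = k * (-(9 / 100)) by ring, Real.exp_nat_mul]
    refine pow_le_pow_left₀ (Real.exp_pos _).le ?_ _
    rw [Real.exp_neg, inv_le_comm₀ (Real.exp_pos _) (by norm_num)]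
    have := Real.add_one_le_exp (9 / 100 : ℝ)
    norm_num at this ⊢
    linarith
  have h3 : (k / Real.exp 1) ^ k / (k.factorial : ℝ) ≤ 2 / 5 := by
    have hs := Stirling.le_factorial_stirling k
    have hsq : 5 / 2 ≤ √(2 * Real.pi * k) := by
      apply Real.le_sqrt_of_sq_le
      have hpi := Real.pi_gt_d2
      have hk1 : (1 : ℝ) ≤ k := by exact_mod_cast hk
      nlinarith
    rw [div_le_iff₀ (by positivity)]
    have := mul_le_mul_of_nonneg_right hsq (by positivity : 0 ≤ ((k : ℝ) / Real.exp 1) ^ k)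
    linarith
  rw [rowWeight, sub_eq_add_neg, Real.exp_add, h1]
  calc (p.choose k : ℝ) * ((k / (Real.exp 1 * p)) ^ k * Real.exp (-(9 / 100 * k)))
      ≤ (p ^ k / k.factorial : ℝ) * ((k / (Real.exp 1 * p)) ^ k * (100 / 109) ^ k) := by
        gcongr
        exact Nat.choose_le_pow_div k p
    _ = (k / Real.exp 1) ^ k / (k.factorial : ℝ) * (100 / 109) ^ k := by
        rw [div_pow, div_pow _ (Real.exp 1), mul_pow]
        field_simp
    _ ≤ _ := by gcongr

lemma sum_rowWeight_le (p : ℕ) : ∑ J : Finset (Fin p), rowWeight p J.card ≤ 109 / 20 := by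
  have h := Finset.sum_powerset_apply_card (rowWeight p) (x := (Finset.univ : Finset (Fin p)))
  rw [Finset.powerset_univ, Finset.card_univ, Fintype.card_fin] at h
  rw [h, Finset.sum_range_succ']
  have h0 : p.choose 0 • rowWeight p 0 = 1 := by simp [rowWeight]
  have hle : ∑ k ∈ Finset.range p, p.choose (k + 1) • rowWeight p (k + 1) ≤
      ∑ k ∈ Finset.range p, 2 / 5 * (100 / 109) * (100 / 109 : ℝ) ^ k := by
    refine Finset.sum_le_sum fun k hk => ?_
    rw [nsmul_eq_mul]
    refine (choose_mul_rowWeight_le (by omega) (Finset.mem_range.1 hk)).trans (le_of_eq ?_)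
    rw [Nat.succ_eq_add_one, pow_succ]
    ring
  rw [h0]
  -- The full series is `2/5 · 100/9 = 40/9`; with the term 1 of the empty set the total is `49/9 <
  -- 109/20`.
  rw [← Finset.mul_sum, geom_sum_eq (by norm_num)] at hle
  have : (0 : ℝ) ≤ (100 / 109 : ℝ) ^ p := by positivity
  simp only [nsmul_eq_mul] at hle ⊢
  norm_num at hle
  linarith

/-- The part of the bound on a projection of the noise that depends on the number of rows. -/
noncomputable def rowCost (p k : ℕ) : ℝ :=
  507 / 100 * k + 3 * (k * Real.log (Real.exp 1 * p / k))

lemma sq_le_of_unit {q n : ℕ} (G : Matrix (Fin q) (Fin n) ℝ) {s : ℝ}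
    (h : ∀ (u : Fin q → ℝ) (v : Fin n → ℝ), u ⬝ᵥ u = 1 → v ⬝ᵥ v = 1 → (u ⬝ᵥ G *ᵥ v) ^ 2 ≤ s)
    (u : Fin q → ℝ) (v : Fin n → ℝ) : (u ⬝ᵥ G *ᵥ v) ^ 2 ≤ s * (u ⬝ᵥ u) * (v ⬝ᵥ v) := by
  have hu0 : 0 ≤ u ⬝ᵥ u := Finset.sum_nonneg fun i _ => mul_self_nonneg _
  have hv0 : 0 ≤ v ⬝ᵥ v := Finset.sum_nonneg fun i _ => mul_self_nonneg _
  rcases hu0.eq_or_lt with hu | hu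
  · rw [dotProduct_self_eq_zero.1 hu.symm]; simp
  rcases hv0.eq_or_lt with hv | hv
  · rw [dotProduct_self_eq_zero.1 hv.symm]; simp
  have hsu := Real.sq_sqrt hu.le
  have hsv := Real.sq_sqrt hv.le
  set a := √(u ⬝ᵥ u)
  set b := √(v ⬝ᵥ v)
  have ha : a ≠ 0 := by rintro h; rw [h] at hsu; simp at hsu; linarith
  have hb : b ≠ 0 := by rintro h; rw [h] at hsv; simp at hsv; linarith
  have := h (a⁻¹ • u) (b⁻¹ • v)
    (by simp only [smul_dotProduct, dotProduct_smul, smul_eq_mul, ← hsu]; field_simp)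
    (by simp only [smul_dotProduct, dotProduct_smul, smul_eq_mul, ← hsv]; field_simp)
  rw [mulVec_smul, smul_dotProduct, dotProduct_smul, smul_eq_mul, smul_eq_mul, mul_pow, mul_pow,
    inv_pow, inv_pow, hsu, hsv] at this
  field_simp at this
  linarith

lemma rowCost_nonneg {p k : ℕ} (hk : k ≤ p) : 0 ≤ rowCost p k := by
  rcases Nat.eq_zero_or_pos k with rfl | hk0
  · simp [rowCost]
  have hk0' : (0 : ℝ) < k := by exact_mod_cast hk0
  have : 0 ≤ Real.log (Real.exp 1 * p / k) := by
    apply Real.log_nonneg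
    rw [le_div_iff₀ hk0', one_mul]
    have h1 : (k : ℝ) ≤ p := by exact_mod_cast hk
    have := Real.add_one_le_exp (1 : ℝ)
    nlinarith
  unfold rowCost
  positivity

lemma rowCost_zero (p : ℕ) : rowCost p 0 = 0 := by simp [rowCost]

/-- Solving the exponential bound on a unit value of the bilinear form of the noise for it. -/
lemma sq_le_of_exp_le {p n q k l : ℕ} {y M : ℝ} (hq : q ≤ k + l) (hM : 0 < M)
    (h : rowWeight p k * rowWeight p l * Real.exp (y ^ 2 / 3 - 7 / 2 * n - 8 / 5 * q) ≤ M) :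
    y ^ 2 ≤ 12 * n + rowCost p k + rowCost p l + 3 * (Real.exp (-n / 2 - 1) * M) := by
  -- Three times the logarithm of the hypothesis: `n` gets `21/2` from the mixture and `3/2` from
  -- `log M`, and each row gets `24/5 + 27/100 = 507/100`.
  have hlog := Real.log_le_log (by unfold rowWeight; positivity) h
  rw [rowWeight, rowWeight, ← Real.exp_add, ← Real.exp_add, Real.log_exp] at hlog
  -- The tangent bound `log t ≤ t - 1` is taken at `t = exp (-n/2 - 1) M`, which makes the
  -- coefficient of `M` exponentially small at the price of `n/2`.
  have hM' := Real.log_le_sub_one_of_pos (mul_pos (Real.exp_pos (-(n : ℝ) / 2 - 1)) hM)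
  rw [Real.log_mul (Real.exp_pos _).ne' hM.ne', Real.log_exp] at hM'
  have hq' : (q : ℝ) ≤ k + l := by exact_mod_cast hq
  simp only [rowCost]
  linarith

/-! ### Uniform control of the projected noise -/

/-- The bound on the squared norm of the projection of the noise on the columns in a union of two
sets of `k` and `l` rows, in terms of the value `M` of a random variable of bounded mean. -/
noncomputable def noiseBound (σ : ℝ) (n p k l : ℕ) (M : ℝ) : ℝ :=
  σ ^ 2 * (12 * n + rowCost p k + rowCost p l + 3 * (Real.exp (-n / 2 - 1) * M))

variable {Ω : Type*} [MeasurableSpace Ω] {P : Measure Ω} [IsProbabilityMeasure P] {m n p : ℕ}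

/-- One variable `M` serves all row sets, so dependence of the matrices on the data is harmless.
Indexing by pairs `(J, K)` with product weights, instead of by their union, makes the cost the sum
of one term per set, as the penalties require. -/
lemma IsGaussianNoise.exists_noiseBound {σ : ℝ≥0} {E : Ω → Matrix (Fin m) (Fin n) ℝ}
    (hE : IsGaussianNoise P σ E) (hn : 0 < n) (X : Matrix (Fin m) (Fin p) ℝ) :
    ∃ M : Ω → ℝ≥0∞, AEMeasurable M P ∧ ∫⁻ ω, M ω ∂P ≤ 30 ∧
      ∀ᵐ ω ∂P, M ω ≠ ∞ ∧ ∀ J K : Finset (Fin p),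
        ProjBound X (E ω) (J ∪ K) (noiseBound σ n p J.card K.card (M ω).toReal) := by
  have hpos : ∀ (J K : Finset (Fin p)) (M : ℝ≥0∞),
      0 ≤ noiseBound σ n p J.card K.card M.toReal := by
    intro J K M
    have h1 := rowCost_nonneg (card_finset_fin_le J)
    have h2 := rowCost_nonneg (card_finset_fin_le K)
    unfold noiseBound
    positivity
  rcases eq_or_ne σ 0 with rfl | hσ
  · refine ⟨0, aemeasurable_const, by simp, ?_⟩
    filter_upwards [hE.ae_eq_zero] with ω hω
    exact ⟨by simp, fun J K => ⟨hpos J K _, by simp [hω, noiseBound]⟩⟩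
  set g : ℝ := √(2 / 5 / n) with hg
  have hn' : (0 : ℝ) < n := by exact_mod_cast hn
  have hg2 : g ^ 2 * n = 2 / 5 := by
    rw [hg, Real.sq_sqrt (by positivity)]; field_simp
  set W : Finset (Fin p) → ℝ≥0∞ := fun J => ENNReal.ofReal (rowWeight p J.card) with hW
  have hσ' : (σ : ℝ) ≠ 0 := by exact_mod_cast hσ
  set T : Finset (Fin p) → Finset (Fin p) → Ω → ℝ≥0∞ := fun J K ω =>
    gaussMixture g ((colBasis X (J ∪ K))ᵀ * ((σ : ℝ)⁻¹ • E ω)) with hT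
  have hTm : ∀ J K, AEMeasurable (T J K) P := fun J K => hE.aemeasurable_gaussMixture g _
  set M : Ω → ℝ≥0∞ := fun ω => ∑ J, ∑ K, W J * W K * T J K ω with hM
  have hMm : AEMeasurable M P := by
    refine Finset.aemeasurable_fun_sum _ fun J _ => Finset.aemeasurable_fun_sum _ fun K _ => ?_
    exact (hTm J K).const_mul _
  have hMint : ∫⁻ ω, M ω ∂P ≤ 30 := by
    have e : ∫⁻ ω, M ω ∂P = (∑ J, W J) * ∑ K, W K := by
      rw [Finset.sum_mul_sum, hM, lintegral_finsetSum' _ fun J _ =>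
        Finset.aemeasurable_fun_sum _ fun K _ => (hTm J K).const_mul _]
      refine Finset.sum_congr rfl fun J _ => ?_
      rw [lintegral_finsetSum' _ fun K _ => (hTm J K).const_mul _]
      refine Finset.sum_congr rfl fun K _ => ?_
      rw [lintegral_const_mul'' _ (hTm J K),
        hE.lintegral_gaussMixture hσ g _ (colBasis_orthonormal X _), mul_one]
    have hs : ∑ J, W J = ENNReal.ofReal (∑ J : Finset (Fin p), rowWeight p J.card) := by
      rw [ENNReal.ofReal_sum_of_nonneg fun J _ => (rowWeight_pos _ _).le]
    have h0 : 0 ≤ ∑ J : Finset (Fin p), rowWeight p J.card :=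
      Finset.sum_nonneg fun J _ => (rowWeight_pos _ _).le
    have h1 := sum_rowWeight_le p
    rw [e, hs, ← ENNReal.ofReal_mul h0]
    -- `(109/20)² = 29.7025`, below 30.
    refine ENNReal.ofReal_le_of_le_toReal ?_
    norm_num
    nlinarith
  refine ⟨M, hMm, hMint, ?_⟩
  have hfin : ∀ᵐ ω ∂P, M ω < ∞ :=
    ae_lt_top' hMm (hMint.trans_lt (by norm_num)).ne
  filter_upwards [hfin] with ω hω
  refine ⟨hω.ne, fun J K => ⟨hpos J K _, sq_le_of_unit _ fun u v hu hv => ?_⟩⟩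
  set y := u ⬝ᵥ ((colBasis X (J ∪ K))ᵀ * ((σ : ℝ)⁻¹ • E ω)) *ᵥ v with hy
  have hEy : u ⬝ᵥ ((colBasis X (J ∪ K))ᵀ * E ω) *ᵥ v = σ * y := by
    rw [hy, Matrix.mul_smul, smul_mulVec, dotProduct_smul, smul_eq_mul]
    field_simp
  have hterm : W J * W K * T J K ω ≤ M ω :=
    (Finset.single_le_sum (f := fun K => W J * W K * T J K ω) (fun _ _ => zero_le)
      (Finset.mem_univ K)).trans
      (Finset.single_le_sum (f := fun J => ∑ K, W J * W K * T J K ω) (fun _ _ => zero_le)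
        (Finset.mem_univ J))
  have hle := (mul_le_mul_right (exp_le_gaussMixture hg2 _ hu hv) (W J * W K)).trans hterm
  rw [hW, ← ENNReal.ofReal_mul (rowWeight_pos _ _).le,
    ← ENNReal.ofReal_mul (mul_pos (rowWeight_pos _ _) (rowWeight_pos _ _)).le,
    ENNReal.ofReal_le_iff_le_toReal hω.ne] at hle
  have hq : (restrictCols X (J ∪ K))ᵀ.rank ≤ J.card + K.card :=
    (rank_restrictCols_le X _).trans (Finset.card_union_le _ _)
  have hMpos : 0 < (M ω).toReal := lt_of_lt_of_le (by unfold rowWeight; positivity) hle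
  rw [hEy, mul_pow, noiseBound]
  exact mul_le_mul_of_nonneg_left (sq_le_of_exp_le hq hMpos hle) (by positivity)

/-! ### Comparison with the penalties and the oracle inequality -/

/-- Twice the noise bound weighted by the ranks is dominated by the two penalties. -/
lemma two_mul_noiseBound_le_pen (σ : ℝ) {M : ℝ} (hM : 0 ≤ M) (B₁ B₂ : Matrix (Fin p) (Fin n) ℝ)
    (hr : B₁.rank ≤ B₂.rank) :
    2 * ((B₁.rank : ℝ) * noiseBound σ n p (rowSupport B₁).card (rowSupport B₂).card M +
      (B₂.rank : ℝ) * noiseBound σ n p (rowSupport B₂).card 0 M) ≤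
      pen 12 σ B₁ + pen 12 σ B₂ + 12 * n * σ ^ 2 * (Real.exp (-n / 2 - 1) * M) := by
  have hr' : (B₁.rank : ℝ) ≤ B₂.rank := by exact_mod_cast hr
  have hn₁ : (B₁.rank : ℝ) ≤ n := by exact_mod_cast B₁.rank_le_width
  have hn₂ : (B₂.rank : ℝ) ≤ n := by exact_mod_cast B₂.rank_le_width
  have hcost := rowCost_nonneg (card_finset_fin_le (rowSupport B₂))
  have hlog : 169 / 100 ≤ Real.log (2 * Real.exp 1) := by
    rw [Real.log_mul two_ne_zero (Real.exp_pos 1).ne', Real.log_exp]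
    have := Real.log_two_gt_d9
    linarith
  -- The constant 12 of the penalty is matched here: `24 n` and the coefficient 12 of the logarithm
  -- agree exactly, and the linear term needs `12 log (2e) ≥ 20.28 = 4 · 5.07`.
  have key : ∀ B : Matrix (Fin p) (Fin n) ℝ,
      2 * ((B.rank : ℝ) * (σ ^ 2 * (12 * n + 2 * rowCost p (rowSupport B).card))) ≤
        pen 12 σ B := by
    intro B
    have h1 : 2 * (12 * n + 2 * rowCost p (rowSupport B).card) ≤
        12 * (2 * (n : ℝ) + Real.log (2 * Real.exp 1) * ((rowSupport B).card : ℝ) +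
        ((rowSupport B).card : ℝ) *
          Real.log (Real.exp 1 * (p : ℝ) / ((rowSupport B).card : ℝ))) := by
      have := mul_le_mul_of_nonneg_right hlog (Nat.cast_nonneg (α := ℝ) (rowSupport B).card)
      unfold rowCost
      linarith
    have h2 := mul_le_mul_of_nonneg_left h1 (by positivity : 0 ≤ σ ^ 2 * (B.rank : ℝ))
    unfold pen
    linarith
  have k₁ := key B₁
  have k₂ := key B₂
  have hcost₁ := rowCost_nonneg (card_finset_fin_le (rowSupport B₁))
  set a := rowCost p (rowSupport B₁).card
  set b := rowCost p (rowSupport B₂).card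
  set R := Real.exp (-(n : ℝ) / 2 - 1) * M
  have hR : 0 ≤ R := by positivity
  simp only [noiseBound, rowCost_zero]
  -- The only mixed term, lower rank times the row cost of the other matrix, is absorbed because of
  -- the ordering of the ranks.
  have e₁ : (B₁.rank : ℝ) * b ≤ B₂.rank * b := mul_le_mul_of_nonneg_right hr' hcost
  have e₂ : 0 ≤ (B₁.rank : ℝ) * a := by positivity
  have e₃ : ((B₁.rank : ℝ) + B₂.rank) * R ≤ 2 * n * R :=
    mul_le_mul_of_nonneg_right (by linarith) hR
  have e : (B₁.rank : ℝ) * (12 * n + a + b + 3 * R) + B₂.rank * (12 * n + b + 0 + 3 * R) ≤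
      B₁.rank * (12 * n + 2 * a) + B₂.rank * (12 * n + 2 * b) + 6 * n * R := by linarith
  have := mul_le_mul_of_nonneg_left e (sq_nonneg σ)
  linarith

lemma frobSq_add_le {a b : ℕ} (M N : Matrix (Fin a) (Fin b) ℝ) :
    frobSq (M + N) ≤ 3 / 2 * frobSq M + 3 * frobSq N := by
  simp only [frobSq, Finset.mul_sum, ← Finset.sum_add_distrib, Matrix.add_apply]
  refine Finset.sum_le_sum fun i _ => Finset.sum_le_sum fun k _ => ?_
  nlinarith [sq_nonneg (M i k - 2 * N i k)]

lemma abs_two_trace_sub_le_pen {σ : ℝ} {M : ℝ} (hM : 0 ≤ M) {X : Matrix (Fin m) (Fin p) ℝ}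
    {E : Matrix (Fin m) (Fin n) ℝ}
    (hb : ∀ J K : Finset (Fin p), ProjBound X E (J ∪ K) (noiseBound σ n p J.card K.card M))
    (B₁ B₂ : Matrix (Fin p) (Fin n) ℝ) :
    |2 * (Eᵀ * (X * B₁ - X * B₂)).trace| ≤ frobSq (X * B₁ - X * B₂) / 2 +
      (pen 12 σ B₁ + pen 12 σ B₂ + 12 * n * σ ^ 2 * (Real.exp (-n / 2 - 1) * M)) := by
  wlog hr : B₁.rank ≤ B₂.rank generalizing B₁ B₂
  · have := this B₂ B₁ (le_of_not_ge hr)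
    rw [← neg_sub (X * B₁), frobSq_neg, Matrix.mul_neg, trace_neg, mul_neg, abs_neg] at this
    linarith
  -- The empty set has cost zero, so a single support is the union with it.
  have h₂ := hb (rowSupport B₂) ∅
  rw [Finset.union_empty, Finset.card_empty] at h₂
  have := abs_two_trace_sub_le X E B₁ B₂ (hb _ _) h₂
  have := two_mul_noiseBound_le_pen σ hM B₁ B₂ hr
  linarith

/-- The oracle inequality on an event where the projections of the noise are controlled. -/
lemma frobSq_le_of_projBound {σ : ℝ} {M : ℝ} (hM : 0 ≤ M) {X : Matrix (Fin m) (Fin p) ℝ}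
    {A : Matrix (Fin p) (Fin n) ℝ} {E Y : Matrix (Fin m) (Fin n) ℝ} (hY : Y = X * A + E)
    (hb : ∀ J K : Finset (Fin p), ProjBound X E (J ∪ K) (noiseBound σ n p J.card K.card M))
    {B C : Matrix (Fin p) (Fin n) ℝ} (hC : criterion 12 σ Y X C ≤ criterion 12 σ Y X B) :
    frobSq (X * A - X * C) ≤ 10 * frobSq (X * A - X * B) + 8 * pen 12 σ B +
      48 * n * σ ^ 2 * (Real.exp (-n / 2 - 1) * M) := by
  have ht := (le_abs_self _).trans (abs_two_trace_sub_le_pen hM hb C B)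
  have hd : frobSq (X * C - X * B) ≤
      3 / 2 * frobSq (X * A - X * C) + 3 * frobSq (X * A - X * B) := by
    have := frobSq_add_le (-(X * A - X * C)) (X * A - X * B)
    rw [frobSq_neg] at this
    convert this using 2
    abel
  have hexp : ∀ D : Matrix (Fin p) (Fin n) ℝ,
      frobSq (Y - X * D) = frobSq E + 2 * (Eᵀ * (X * A - X * D)).trace +
        frobSq (X * A - X * D) := by
    intro D
    rw [← frobSq_add, hY]
    congr 1
    abel
  have hsub : (Eᵀ * (X * C - X * B)).trace =
      (Eᵀ * (X * A - X * B)).trace - (Eᵀ * (X * A - X * C)).trace := by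
    simp only [Matrix.mul_sub, trace_sub]
    ring
  rw [criterion, criterion, hexp, hexp] at hC
  rw [hsub] at ht
  -- Half of `hd` puts `3/4` of the risk on the right; the remaining quarter is bounded by `5/2` of
  -- the competitor's risk, twice its penalty and `12 n σ²` times the remainder. Multiplying by 4
  -- gives 10, 8 and 48.
  linarith

end JRRS

/-! ### Taking expectations -/

theorem theorem2 {Ω : Type*} [MeasurableSpace Ω] (P : Measure Ω) [IsProbabilityMeasure P]
    {m n p : ℕ} (X : Matrix (Fin m) (Fin p) ℝ) (A : Matrix (Fin p) (Fin n) ℝ) (σ : ℝ≥0)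
    (E Y : Ω → Matrix (Fin m) (Fin n) ℝ)
    (hE : JRRS.IsGaussianNoise P σ E)
    (hY : ∀ ω, Y ω = X * A + E ω)
    {ι : Type*} [Countable ι] (B : ι → Ω → Matrix (Fin p) (Fin n) ℝ)
    (hBmeas : ∀ j i k, AEMeasurable (fun ω => B j ω i k) P)
    (hBne : ∀ j, ∀ᵐ ω ∂P, B j ω ≠ 0)
    (Bsel : Ω → Matrix (Fin p) (Fin n) ℝ)
    (hBselmeas : ∀ i k, AEMeasurable (fun ω => Bsel ω i k) P)
    (hBsel : ∀ᵐ ω ∂P, JRRS.IsSelected 12 (σ : ℝ) (Y ω) X (fun j => B j ω) (Bsel ω)) :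
    ∫⁻ ω, ENNReal.ofReal (JRRS.frobSq (X * A - X * Bsel ω)) ∂P ≤
      (⨅ j, (10 * ∫⁻ ω, ENNReal.ofReal (JRRS.frobSq (X * A - X * B j ω)) ∂P +
        8 * ∫⁻ ω, ENNReal.ofReal (JRRS.pen 12 (σ : ℝ) (B j ω)) ∂P)) +
      ENNReal.ofReal (768 * (n : ℝ) * (σ : ℝ) ^ 2 * Real.exp (-(n : ℝ) / 2)) := by
  rcases Nat.eq_zero_or_pos n with rfl | hn
  · simp [JRRS.frobSq]
  obtain ⟨M, hMm, hMint, hM⟩ := hE.exists_noiseBound hn X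
  rw [ENNReal.iInf_add]
  refine le_iInf fun j => ?_
  set c : ℝ := 48 * n * (σ : ℝ) ^ 2 * Real.exp (-n / 2 - 1) with hc
  have hc0 : 0 ≤ c := by positivity
  have hpt : ∀ᵐ ω ∂P, ENNReal.ofReal (JRRS.frobSq (X * A - X * Bsel ω)) ≤
      10 * ENNReal.ofReal (JRRS.frobSq (X * A - X * B j ω)) +
      (8 * ENNReal.ofReal (JRRS.pen 12 (σ : ℝ) (B j ω)) + ENNReal.ofReal c * M ω) := by
    filter_upwards [hBsel, hM] with ω hsel hω
    obtain ⟨j₀, hj₀, hmin⟩ := hsel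
    have h := JRRS.frobSq_le_of_projBound ENNReal.toReal_nonneg (hY ω) hω.2 (hmin j)
    rw [← hj₀] at h
    have e : 48 * n * (σ : ℝ) ^ 2 * (Real.exp (-n / 2 - 1) * (M ω).toReal) =
        c * (M ω).toReal := by rw [hc]; ring
    rw [e] at h
    calc _ ≤ ENNReal.ofReal (10 * JRRS.frobSq (X * A - X * B j ω) +
          (8 * JRRS.pen 12 (σ : ℝ) (B j ω) + c * (M ω).toReal)) :=
          ENNReal.ofReal_le_ofReal (by linarith)
      _ ≤ ENNReal.ofReal (10 * JRRS.frobSq (X * A - X * B j ω)) +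
          (ENNReal.ofReal (8 * JRRS.pen 12 (σ : ℝ) (B j ω)) +
            ENNReal.ofReal (c * (M ω).toReal)) := by
          refine ENNReal.ofReal_add_le.trans ?_
          gcongr
          exact ENNReal.ofReal_add_le
      _ = _ := by
          rw [ENNReal.ofReal_mul (by norm_num), ENNReal.ofReal_mul (by norm_num),
            ENNReal.ofReal_mul hc0, ENNReal.ofReal_toReal hω.1]
          norm_num
  have hFm : AEMeasurable
      (fun ω => 10 * ENNReal.ofReal (JRRS.frobSq (X * A - X * B j ω))) P := by
    refine AEMeasurable.const_mul (AEMeasurable.ennreal_ofReal ?_) _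
    simp only [JRRS.frobSq, Matrix.sub_apply, Matrix.mul_apply]
    exact Finset.aemeasurable_fun_sum _ fun i _ => Finset.aemeasurable_fun_sum _ fun k _ =>
      ((Finset.aemeasurable_fun_sum _ fun l _ =>
        (hBmeas j l k).const_mul _).const_sub _).pow_const 2
  have hrem : ENNReal.ofReal c * ∫⁻ ω, M ω ∂P ≤
      ENNReal.ofReal (768 * (n : ℝ) * (σ : ℝ) ^ 2 * Real.exp (-(n : ℝ) / 2)) := by
    calc ENNReal.ofReal c * ∫⁻ ω, M ω ∂P ≤ ENNReal.ofReal c * ENNReal.ofReal 30 := by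
          gcongr
          simpa using hMint
      _ = ENNReal.ofReal (c * 30) := (ENNReal.ofReal_mul hc0).symm
      _ ≤ _ := by
          refine ENNReal.ofReal_le_ofReal ?_
          -- Here `48 · 30 = 1440`, and `e ≥ 2` brings it down to 720, below 768.
          have he : Real.exp (-(n : ℝ) / 2 - 1) ≤ Real.exp (-(n : ℝ) / 2) / 2 := by
            rw [Real.exp_sub]
            have := Real.add_one_le_exp (1 : ℝ)
            gcongr
            linarith
          have := mul_le_mul_of_nonneg_left he (by positivity : 0 ≤ 1440 * n * (σ : ℝ) ^ 2)
          have h0 : 0 ≤ n * (σ : ℝ) ^ 2 * Real.exp (-(n : ℝ) / 2) := by positivity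
          rw [hc]
          linarith
  calc _ ≤ ∫⁻ ω, (10 * ENNReal.ofReal (JRRS.frobSq (X * A - X * B j ω)) +
      (8 * ENNReal.ofReal (JRRS.pen 12 (σ : ℝ) (B j ω)) + ENNReal.ofReal c * M ω)) ∂P :=
        lintegral_mono_ae hpt
    _ = 10 * ∫⁻ ω, ENNReal.ofReal (JRRS.frobSq (X * A - X * B j ω)) ∂P +
        8 * ∫⁻ ω, ENNReal.ofReal (JRRS.pen 12 (σ : ℝ) (B j ω)) ∂P +
        ENNReal.ofReal c * ∫⁻ ω, M ω ∂P := by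
        -- Additivity needs only one measurable summand each time; taking the risk and then `M`
        -- avoids any measurability of the penalty.
        rw [lintegral_add_left' hFm, lintegral_add_right' _ (hMm.const_mul _),
          lintegral_const_mul' _ _ (by norm_num), lintegral_const_mul' _ _ (by norm_num),
          lintegral_const_mul' _ _ ENNReal.ofReal_ne_top, add_assoc]
    _ ≤ _ := by gcongr
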